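/- Let $n\ge 0$ and let $SU_{\rm loc}(2^n)=\{U_1\otimes\cdots\otimes U_n : U_\ell\in SU(2)\}$. For $A,C\in \mathrm{Mat}_{2^n}(\mathbb C)$ let $$W_{\rm loc}(C,A)=\{\operatorname{tr}(C^\dagger KAK^\dagger) : K\in SU_{\rm loc}(2^n)\}$$ be the local $C$-numerical range of $A$. Call $A$ locally sign-reversible if $KAK^\dagger=-A$ for some $K\in SU_{\rm loc}(2^n)$, call a set $S\subseteq\mathbb C$ rotationally symmetric if $e^{i\theta}S\subseteq S$ for all real $\theta$, and let $\|\cdot\|_2$ be the Frobenius norm. Discs are closed and may have radius $0$. 1. Let $A_+\in \mathrm{Mat}_{2^n}(\mathbb C)$ and $A_-:=A_+^\dagger$ be such that, for every $C\in \mathrm{Mat}_{2^n}(\mathbb C)$, both $W_{\rm loc}(C,A_+)$ and $W_{\rm loc}(C,A_-)$ are circular discs centred at $0$. Then there is a $K\in SU_{\rm loc}(2^n)$ with $K(A_++\lambda A_-)K^\dagger=-(A_++\lambda A_-)$ for all $\lambda\in\mathbb C$. In particular the Hermitian matrix $H:=A_++A_-$ is locally sign-reversible, and $W_{\rm loc}(H,H)$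 is the real interval $[-\|H\|_2^2,\,\|H\|_2^2]$. 2. The converse fails in general: for some $n$ there is a locally sign-reversible Hermitian $H\in\mathrm{Mat}_{2^n}(\mathbb C)$ that cannot be written as $H=H_++H_-$ with $H_-=H_+^\dagger$ and with $W_{\rm loc}(C,H_+)$ and $W_{\rm loc}(C,H_-)$ rotationally symmetric for every $C$. 3. Every locally sign-reversible Hermitian $H\in\mathrm{Mat}_{2^n}(\mathbb C)$ can be written as $H=\sum_{\ell=1}^m\big(H_+^{(\ell)}+H_-^{(\ell)}\big)$ with $m\le\binom{2^n}{2}$ and $H_-^{(\ell)}=(H_+^{(\ell)})^\dagger$, such that for every $\ell$ and every $C\in\mathrm{Mat}_{2^n}(\mathbb C)$ one has $W_{\rm loc}(C,H_+^{(\ell)})=W_{\rm loc}(C,H_-^{(\ell)})$, and this set is rotationally symmetric and is in fact a circular disc centred at $0$. -/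

import Mathlib

namespace LocalNumericalRange

/-- Computational basis labels of `n` qubits; there are `2 ^ n` of them. -/
abbrev Qubits (n : ℕ) : Type := Fin n → Fin 2

/-- The complex matrices of size `2 ^ n`, with rows and columns labelled by the
computational basis. -/
abbrev QMat (n : ℕ) : Type := Matrix (Qubits n) (Qubits n) ℂ

/-- The tensor (Kronecker) product `U 0 ⊗ U 1 ⊗ ⋯ ⊗ U (n - 1)` of `2 × 2` matrices. -/
def tensor {n : ℕ} (U : Fin n → Matrix (Fin 2) (Fin 2) ℂ) : QMat n :=
  Matrix.of fun i j => ∏ l, U l (i l) (j l)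

/-- The local unitary operations `SU(2) ⊗ ⋯ ⊗ SU(2)`. -/
def SUloc (n : ℕ) : Set (QMat n) :=
  {K | ∃ U : Fin n → Matrix (Fin 2) (Fin 2) ℂ,
    (∀ l, U l ∈ Matrix.specialUnitaryGroup (Fin 2) ℂ) ∧ K = tensor U}

/-- The local `C`-numerical range `{tr (C† K A K†) | K ∈ SUloc n}` of `A`. -/
def Wloc {n : ℕ} (C A : QMat n) : Set ℂ :=
  {z | ∃ K ∈ SUloc n, z = (C.conjTranspose * (K * A * K.conjTranspose)).trace}

/-- `A` is sign-reversible by a local unitary operation. -/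
def LocallySignReversible {n : ℕ} (A : QMat n) : Prop :=
  ∃ K ∈ SUloc n, K * A * K.conjTranspose = -A

/-- `S` is a closed circular disc centred at the origin; radius `0` is allowed, since
`Wloc 0 A = {0}`. -/
def IsCentredDisc (S : Set ℂ) : Prop :=
  ∃ r : ℝ, 0 ≤ r ∧ S = Metric.closedBall 0 r

/-- `S` is invariant under all rotations about the origin. -/
def IsRotationallySymmetric (S : Set ℂ) : Prop :=
  ∀ u : ℂ, ‖u‖ = 1 → ∀ z ∈ S, u * z ∈ S

/-- The Frobenius (Hilbert–Schmidt) norm. -/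
noncomputable def frobNorm {n : ℕ} (A : QMat n) : ℝ :=
  (Matrix.frobeniusNormedAddCommGroup : NormedAddCommGroup (QMat n)).toNorm.norm A

end LocalNumericalRange

/-!
Since every `K` in `SUloc n` preserves the Frobenius norm, the equality case of the Cauchy–Schwarz
inequality shows that `u * ‖A‖ ^ 2` with `‖u‖ = 1` lies in `Wloc A A` only if `u • A` lies in the
local unitary orbit of `A`. Hence rotational symmetry of the single set `Wloc A A` already makes the
orbit of `A` invariant under all phases, and a `K` that conjugates `A` to `-A` also conjugates `Aᴴ`
to `-Aᴴ`. The numerical range of a Hermitian `H` with respect to itself is real and connected, so it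
is an interval, and sign-reversibility puts both extremes allowed by Cauchy–Schwarz into it.

If `K * H * Kᴴ = -H`, then in a product basis of eigenvectors of `K` the diagonal of `H` vanishes,
so `H` is a sum of pairs `single i j z`, `(single i j z)ᴴ` with `i ≠ j`. A diagonal one-qubit
matrix on a qubit where `i` and `j` differ multiplies `single i j z` by any prescribed phase, and
triangularising a `2 × 2` block of `C` on that qubit shows that `0` lies in the range. A compact
connected rotationally symmetric set containing `0` is a disc.

One pair does not suffice for `H = |0…0⟩⟨0…0| - |1…1⟩⟨1…1|` with `n ≥ 3`. If `H = P + Pᴴ` and the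
product of the one-qubit matrices `U l` conjugates `P` to `u • P`, then comparing correlations of
Pauli matrices `Z` on a single qubit forces the polarization of every `U l |0⟩` to be `u.re`, so
the three-qubit correlations of `P` would make `u.re ^ 3` the real part of a linear function of `u`.
-/

open Matrix

namespace LocalNumericalRange

section Trace

variable {m n R : Type*} [Fintype n]

lemma conjTranspose_mul_mul_conjTranspose [NonUnitalSemiring R] [StarRing R] (K : Matrix m n R)
    (A : Matrix n n R) : (K * A * Kᴴ)ᴴ = K * Aᴴ * Kᴴ := by
  simp only [conjTranspose_mul, conjTranspose_conjTranspose, Matrix.mul_assoc]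

variable [Fintype m]

lemma star_trace_conjTranspose_mul [NonUnitalSemiring R] [StarRing R] (A B : Matrix m n R) :
    star (Aᴴ * B).trace = (Bᴴ * A).trace := by
  rw [← trace_conjTranspose, conjTranspose_mul, conjTranspose_conjTranspose]

/- This is the equality case of the Cauchy–Schwarz inequality for the Hilbert–Schmidt inner
product. -/
lemma eq_of_trace_conjTranspose_mul_eq [NonUnitalRing R] [PartialOrder R] [StarRing R]
    [StarOrderedRing R] [NoZeroDivisors R] {A B : Matrix m n R}
    (hB : (Bᴴ * B).trace = (Aᴴ * A).trace) (hAB : (Aᴴ * B).trace = (Aᴴ * A).trace) : B = A := by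
  have hBA : (Bᴴ * A).trace = (Aᴴ * A).trace := by
    rw [← star_trace_conjTranspose_mul, hAB, star_trace_conjTranspose_mul]
  have hsub : ((B - A)ᴴ * (B - A)).trace = 0 := by
    simp only [conjTranspose_sub, Matrix.sub_mul, Matrix.mul_sub, trace_sub, hB, hAB, hBA, sub_self]
  exact sub_eq_zero.mp (trace_conjTranspose_mul_self_eq_zero_iff.mp hsub)

lemma abs_re_trace_conjTranspose_mul_le {A B : Matrix m n ℂ}
    (hB : (Bᴴ * B).trace = (Aᴴ * A).trace) : |(Aᴴ * B).trace.re| ≤ (Aᴴ * A).trace.re := by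
  have hnonneg (C : Matrix m n ℂ) : 0 ≤ (Cᴴ * C).trace.re := by
    open scoped ComplexOrder in
    exact (Complex.nonneg_iff.mp (posSemidef_conjTranspose_mul_self C).trace_nonneg).1
  have hBA : (Bᴴ * A).trace.re = (Aᴴ * B).trace.re := by
    rw [← star_trace_conjTranspose_mul, Complex.star_def, Complex.conj_re]
  have hadd := hnonneg (A + B)
  have hsub := hnonneg (A - B)
  simp only [conjTranspose_add, conjTranspose_sub, Matrix.add_mul, Matrix.mul_add, Matrix.sub_mul,
    Matrix.mul_sub, trace_add, trace_sub, Complex.add_re, Complex.sub_re, hB, hBA] at hadd hsub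
  rw [abs_le]
  constructor <;> linarith

lemma im_trace_mul_eq_zero {A B : Matrix n n ℂ} (hA : A.IsHermitian) (hB : B.IsHermitian) :
    (A * B).trace.im = 0 := by
  have h := star_trace_conjTranspose_mul A B
  rw [hA.eq, hB.eq, trace_mul_comm B A] at h
  exact Complex.conj_eq_iff_im.mp h

lemma trace_mul_add_conjTranspose {A : Matrix n n ℂ} (hA : A.IsHermitian) (B : Matrix n n ℂ) :
    (A * (B + Bᴴ)).trace = ((2 * (A * B).trace.re : ℝ) : ℂ) := by
  have h : (A * Bᴴ).trace = star (A * B).trace := by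
    rw [trace_mul_comm, ← star_trace_conjTranspose_mul, hA.eq]
  rw [Matrix.mul_add, trace_add, h, Complex.star_def, Complex.add_conj]

lemma trace_conjTranspose_mul_self_conj [DecidableEq n] {K : Matrix m n ℂ} (hK : Kᴴ * K = 1)
    (A : Matrix n n ℂ) : ((K * A * Kᴴ)ᴴ * (K * A * Kᴴ)).trace = (Aᴴ * A).trace := by
  calc ((K * A * Kᴴ)ᴴ * (K * A * Kᴴ)).trace
      = (K * (Aᴴ * (Kᴴ * K) * A * Kᴴ)).trace := by
        rw [conjTranspose_mul_mul_conjTranspose]; simp only [Matrix.mul_assoc]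
    _ = (Aᴴ * A).trace := by
        rw [trace_mul_comm, Matrix.mul_assoc, hK, Matrix.mul_one, Matrix.mul_one]

end Trace

lemma trace_conjTranspose_mul_self_eq_frobNorm_sq {n : ℕ} (A : QMat n) :
    (Aᴴ * A).trace = ((frobNorm A ^ 2 : ℝ) : ℂ) := by
  have h : frobNorm A = (∑ i, ∑ j, ‖A i j‖ ^ (2 : ℝ)) ^ (1 / 2 : ℝ) := by
    let _ : NormedAddCommGroup (QMat n) := frobeniusNormedAddCommGroup
    exact frobenius_norm_def A
  rw [h, ← Real.sqrt_eq_rpow, Real.sq_sqrt (by positivity), Finset.sum_comm]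
  simp [trace, mul_apply, Complex.conj_mul']

section SpecialUnitary

/-- The matrix with first column `v` and determinant `‖v‖ ^ 2` whose columns are orthogonal. As
`v` runs over the unit sphere of `ℂ²` it runs over `SU(2)`. -/
def suMatrix (v : EuclideanSpace ℂ (Fin 2)) : Matrix (Fin 2) (Fin 2) ℂ :=
  !![v 0, -star (v 1); v 1, star (v 0)]

lemma det_suMatrix (v : EuclideanSpace ℂ (Fin 2)) : (suMatrix v).det = (‖v‖ : ℂ) ^ 2 := by
  rw [← Complex.ofReal_pow, EuclideanSpace.norm_sq_eq]
  simp [suMatrix, det_fin_two, Complex.mul_conj', Complex.conj_mul']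

lemma conjTranspose_suMatrix (v : EuclideanSpace ℂ (Fin 2)) :
    (suMatrix v)ᴴ = (suMatrix v).adjugate := by
  rw [adjugate_fin_two]
  ext i j
  fin_cases i <;> fin_cases j <;> simp [suMatrix]

lemma suMatrix_mem {v : EuclideanSpace ℂ (Fin 2)} (hv : ‖v‖ = 1) :
    suMatrix v ∈ specialUnitaryGroup (Fin 2) ℂ := by
  have hdet : (suMatrix v).det = 1 := by simp [det_suMatrix, hv]
  refine mem_specialUnitaryGroup_iff.mpr ⟨mem_unitaryGroup_iff.mpr ?_, hdet⟩
  rw [star_eq_conjTranspose, conjTranspose_suMatrix, mul_adjugate, hdet, one_smul]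

lemma conjTranspose_mem_specialUnitaryGroup {ι R : Type*} [Fintype ι] [DecidableEq ι]
    [CommRing R] [StarRing R] {U : Matrix ι ι R} (hU : U ∈ specialUnitaryGroup ι R) :
    Uᴴ ∈ specialUnitaryGroup ι R :=
  (star (⟨U, hU⟩ : specialUnitaryGroup ι R)).2

lemma conjTranspose_mul_self_of_mem_specialUnitaryGroup {ι R : Type*} [Fintype ι] [DecidableEq ι]
    [CommRing R] [StarRing R] {U : Matrix ι ι R} (hU : U ∈ specialUnitaryGroup ι R) : Uᴴ * U = 1 :=
  mem_unitaryGroup_iff'.mp (mem_specialUnitaryGroup_iff.mp hU).1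

lemma conjTranspose_eq_adjugate {ι R : Type*} [Fintype ι] [DecidableEq ι]
    [CommRing R] [StarRing R] {U : Matrix ι ι R} (hU : U ∈ specialUnitaryGroup ι R) :
    Uᴴ = U.adjugate := by
  rw [← Matrix.mul_one Uᴴ, ← one_smul R (1 : Matrix ι ι R),
    ← (mem_specialUnitaryGroup_iff.mp hU).2, ← mul_adjugate, ← Matrix.mul_assoc,
    conjTranspose_mul_self_of_mem_specialUnitaryGroup hU, Matrix.one_mul]

lemma exists_eq_suMatrix {U : Matrix (Fin 2) (Fin 2) ℂ} (hU : U ∈ specialUnitaryGroup (Fin 2) ℂ) :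
    ∃ v : EuclideanSpace ℂ (Fin 2), ‖v‖ = 1 ∧ U = suMatrix v := by
  have hadj := conjTranspose_eq_adjugate hU
  rw [adjugate_fin_two] at hadj
  have h11 : star (U 0 0) = U 1 1 := by simpa using congrFun (congrFun hadj 0) 0
  have h01 : star (U 1 0) = -U 0 1 := by simpa using congrFun (congrFun hadj 0) 1
  have heq : U = suMatrix !₂[U 0 0, U 1 0] := by
    ext i j
    fin_cases i <;> fin_cases j <;> simp [suMatrix, ← h11, -RCLike.star_def, h01]
  refine ⟨_, ?_, heq⟩
  have hdet := (mem_specialUnitaryGroup_iff.mp hU).2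
  rw [heq, det_suMatrix] at hdet
  exact (pow_eq_one_iff_of_nonneg (norm_nonneg _) two_ne_zero).mp (mod_cast hdet)

lemma specialUnitaryGroup_eq_image :
    (specialUnitaryGroup (Fin 2) ℂ : Set (Matrix (Fin 2) (Fin 2) ℂ)) =
      suMatrix '' Metric.sphere 0 1 := by
  ext U
  constructor
  · intro hU
    obtain ⟨v, hv, rfl⟩ := exists_eq_suMatrix hU
    exact ⟨v, mem_sphere_zero_iff_norm.mpr hv, rfl⟩
  · rintro ⟨v, hv, rfl⟩
    exact suMatrix_mem (mem_sphere_zero_iff_norm.mp hv)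

lemma continuous_suMatrix : Continuous suMatrix := by
  refine continuous_matrix fun i j => ?_
  fin_cases i <;> fin_cases j <;>
    simp only [suMatrix, Fin.zero_eta, Fin.mk_one, of_apply, cons_val', cons_val_zero, cons_val_one,
      cons_val_fin_one] <;>
    fun_prop

lemma isCompact_specialUnitaryGroup :
    IsCompact (specialUnitaryGroup (Fin 2) ℂ : Set (Matrix (Fin 2) (Fin 2) ℂ)) := by
  rw [specialUnitaryGroup_eq_image]
  exact (isCompact_sphere _ _).image continuous_suMatrix

lemma isPreconnected_specialUnitaryGroup :
    IsPreconnected (specialUnitaryGroup (Fin 2) ℂ : Set (Matrix (Fin 2) (Fin 2) ℂ)) := by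
  have hrank : 1 < Module.rank ℝ (EuclideanSpace ℂ (Fin 2)) := by
    rw [← Module.finrank_eq_rank, ← Nat.cast_one, Nat.cast_lt,
      ← Module.finrank_mul_finrank ℝ ℂ (EuclideanSpace ℂ (Fin 2))]
    simp
  rw [specialUnitaryGroup_eq_image]
  exact (isPreconnected_sphere hrank _ _).image _ continuous_suMatrix.continuousOn

lemma exists_unit_eigenvector (M : Matrix (Fin 2) (Fin 2) ℂ) :
    ∃ (μ : ℂ) (v : EuclideanSpace ℂ (Fin 2)), ‖v‖ = 1 ∧ M *ᵥ v = μ • ⇑v := by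
  obtain ⟨μ, hμ⟩ := Module.End.exists_eigenvalue (toEuclideanLin M)
  obtain ⟨v, hv⟩ := hμ.exists_hasEigenvector
  have h := congrArg WithLp.ofLp hv.apply_eq_smul
  refine ⟨μ, (‖v‖⁻¹ : ℂ) • v, norm_smul_inv_norm hv.2, ?_⟩
  have h' : M *ᵥ v = μ • ⇑v := by simpa using h
  simp only [WithLp.ofLp_smul, mulVec_smul, h', smul_comm μ]

lemma exists_conj_apply_one_zero_eq_zero (M : Matrix (Fin 2) (Fin 2) ℂ) :
    ∃ V ∈ specialUnitaryGroup (Fin 2) ℂ, (Vᴴ * M * V) 1 0 = 0 := by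
  obtain ⟨μ, v, hv, hMv⟩ := exists_unit_eigenvector M
  have hV := suMatrix_mem hv
  have hcol : (suMatrix v).col 0 = v := by
    ext i
    fin_cases i <;> rfl
  refine ⟨suMatrix v, hV, ?_⟩
  calc ((suMatrix v)ᴴ * M * suMatrix v) 1 0
      = ((suMatrix v)ᴴ *ᵥ (M *ᵥ (suMatrix v).col 0)) 1 := by
        rw [mulVec_mulVec]; rfl
    _ = μ * ((suMatrix v)ᴴ * suMatrix v) 1 0 := by
        rw [hcol, hMv, mulVec_smul, ← hcol]; rfl
    _ = 0 := by
        simp [conjTranspose_mul_self_of_mem_specialUnitaryGroup hV]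

lemma exists_conj_apply_eq_zero (M : Matrix (Fin 2) (Fin 2) ℂ) {x y : Fin 2} (hxy : x ≠ y) :
    ∃ V ∈ specialUnitaryGroup (Fin 2) ℂ, (Vᴴ * M * V) x y = 0 := by
  obtain ⟨rfl, rfl⟩ | ⟨rfl, rfl⟩ : (x = 1 ∧ y = 0) ∨ (x = 0 ∧ y = 1) := by omega
  · exact exists_conj_apply_one_zero_eq_zero M
  · obtain ⟨V, hV, h⟩ := exists_conj_apply_one_zero_eq_zero Mᴴ
    refine ⟨V, hV, ?_⟩
    have hstar := congrArg star h
    rwa [← conjTranspose_apply, star_zero, conjTranspose_mul, conjTranspose_mul,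
      conjTranspose_conjTranspose, conjTranspose_conjTranspose, ← Matrix.mul_assoc] at hstar

lemma exists_conj_eq_diagonal {U : Matrix (Fin 2) (Fin 2) ℂ}
    (hU : U ∈ specialUnitaryGroup (Fin 2) ℂ) :
    ∃ V ∈ specialUnitaryGroup (Fin 2) ℂ, ∃ d : Fin 2 → ℂ, Vᴴ * U * V = diagonal d := by
  obtain ⟨V, hV, h⟩ := exists_conj_apply_one_zero_eq_zero U
  obtain ⟨v, -, hv⟩ := exists_eq_suMatrix
    (mul_mem (mul_mem (conjTranspose_mem_specialUnitaryGroup hV) hU) hV)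
  have hv1 : v 1 = 0 := by simpa [hv, suMatrix] using h
  refine ⟨V, hV, ![v 0, star (v 0)], ?_⟩
  rw [hv]
  ext i j
  fin_cases i <;> fin_cases j <;> simp [suMatrix, hv1]

lemma exists_diagonal_mem_specialUnitaryGroup {x y : Fin 2} (hxy : x ≠ y) {u : ℂ} (hu : ‖u‖ = 1) :
    ∃ d : Fin 2 → ℂ, diagonal d ∈ specialUnitaryGroup (Fin 2) ℂ ∧ d x * star (d y) = u := by
  obtain ⟨w, hw⟩ := IsAlgClosed.exists_pow_nat_eq u (n := 2) two_pos
  have hw1 : ‖w‖ = 1 := by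
    rw [← pow_eq_one_iff_of_nonneg (norm_nonneg w) two_ne_zero, ← norm_pow, hw, hu]
  have hmem {v : ℂ} (hv : ‖v‖ = 1) :
      diagonal ![v, star v] ∈ specialUnitaryGroup (Fin 2) ℂ := by
    convert! suMatrix_mem (v := !₂[v, 0]) (by simp [EuclideanSpace.norm_eq, hv]) using 1
    ext a b
    fin_cases a <;> fin_cases b <;> simp [suMatrix]
  obtain ⟨rfl, rfl⟩ | ⟨rfl, rfl⟩ : (x = 0 ∧ y = 1) ∨ (x = 1 ∧ y = 0) := by omega
  · exact ⟨_, hmem hw1, by simp [← hw, sq]⟩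
  · exact ⟨_, hmem (v := star w) (by simpa using hw1), by simp [← hw, sq]⟩

end SpecialUnitary

section Tensor

variable {n : ℕ}

lemma tensor_mul (U V : Fin n → Matrix (Fin 2) (Fin 2) ℂ) :
    tensor U * tensor V = tensor fun l => U l * V l := by
  ext i j
  simp only [tensor, mul_apply, of_apply, Fintype.prod_sum, Finset.prod_mul_distrib]

lemma conjTranspose_tensor (U : Fin n → Matrix (Fin 2) (Fin 2) ℂ) :
    (tensor U)ᴴ = tensor fun l => (U l)ᴴ := by
  ext i j
  simp only [tensor, conjTranspose_apply, of_apply, star_prod]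

lemma tensor_diagonal (d : Fin n → Fin 2 → ℂ) :
    tensor (fun l => diagonal (d l)) = diagonal fun i => ∏ l, d l (i l) := by
  ext i j
  simp only [tensor, of_apply, diagonal_apply, Finset.prod_ite_zero, Finset.mem_univ,
    true_imp_iff, funext_iff]

lemma tensor_single (i j : Qubits n) (z : Fin n → ℂ) :
    tensor (fun l => single (i l) (j l) (z l)) = single i j (∏ l, z l) := by
  ext a b
  simp only [tensor, of_apply, single_apply, Finset.prod_ite_zero, Finset.mem_univ, true_imp_iff,
    forall_and, funext_iff]

lemma tensor_one : tensor (fun _ : Fin n => (1 : Matrix (Fin 2) (Fin 2) ℂ)) = 1 := by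
  simp only [← diagonal_one, tensor_diagonal, Finset.prod_const_one]

lemma trace_tensor (U : Fin n → Matrix (Fin 2) (Fin 2) ℂ) :
    (tensor U).trace = ∏ l, (U l).trace := by
  simp only [trace, diag, tensor, of_apply, Fintype.prod_sum]

lemma continuous_tensor : Continuous (tensor (n := n)) := by
  refine continuous_matrix fun i j => ?_
  simp only [tensor, of_apply]
  fun_prop

end Tensor

section SUloc

variable {n : ℕ} {K L : QMat n}

lemma SUloc_eq_image :
    SUloc n = tensor '' Set.univ.pi fun _ : Fin n =>
      (specialUnitaryGroup (Fin 2) ℂ : Set (Matrix (Fin 2) (Fin 2) ℂ)) := by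
  ext K
  simp only [SUloc, Set.mem_ofPred_eq, Set.mem_image, Set.mem_univ_pi, SetLike.mem_coe, eq_comm]

lemma isCompact_SUloc : IsCompact (SUloc n) := by
  rw [SUloc_eq_image]
  exact (isCompact_univ_pi fun _ => isCompact_specialUnitaryGroup).image continuous_tensor

lemma isPreconnected_SUloc : IsPreconnected (SUloc n) := by
  rw [SUloc_eq_image]
  exact (isPreconnected_univ_pi fun _ => isPreconnected_specialUnitaryGroup).image _
    continuous_tensor.continuousOn

lemma one_mem_SUloc : (1 : QMat n) ∈ SUloc n :=
  ⟨fun _ => 1, fun _ => one_mem _, tensor_one.symm⟩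

lemma mul_mem_SUloc (hK : K ∈ SUloc n) (hL : L ∈ SUloc n) : K * L ∈ SUloc n := by
  obtain ⟨U, hU, rfl⟩ := hK
  obtain ⟨V, hV, rfl⟩ := hL
  exact ⟨_, fun l => mul_mem (hU l) (hV l), tensor_mul U V⟩

lemma conjTranspose_mem_SUloc (hK : K ∈ SUloc n) : Kᴴ ∈ SUloc n := by
  obtain ⟨U, hU, rfl⟩ := hK
  exact ⟨_, fun l => conjTranspose_mem_specialUnitaryGroup (hU l), conjTranspose_tensor U⟩

lemma conjTranspose_mul_self_of_mem_SUloc (hK : K ∈ SUloc n) : Kᴴ * K = 1 := by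
  obtain ⟨U, hU, rfl⟩ := hK
  simp only [conjTranspose_tensor, tensor_mul,
    conjTranspose_mul_self_of_mem_specialUnitaryGroup (hU _), tensor_one]

lemma mul_conjTranspose_self_of_mem_SUloc (hK : K ∈ SUloc n) : K * Kᴴ = 1 :=
  mul_eq_one_comm.mp (conjTranspose_mul_self_of_mem_SUloc hK)

end SUloc

section OnQubit

variable {n : ℕ}

/-- The one-qubit matrix `U` acting on the qubit `l`, that is `1 ⊗ ⋯ ⊗ U ⊗ ⋯ ⊗ 1`. -/
def onQubit (l : Fin n) (U : Matrix (Fin 2) (Fin 2) ℂ) : QMat n :=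
  tensor (Function.update (fun _ => 1) l U)

lemma onQubit_mem_SUloc (l : Fin n) {U : Matrix (Fin 2) (Fin 2) ℂ}
    (hU : U ∈ specialUnitaryGroup (Fin 2) ℂ) : onQubit l U ∈ SUloc n := by
  refine ⟨_, fun k => ?_, rfl⟩
  obtain rfl | hk := eq_or_ne k l
  · rwa [Function.update_self]
  · rw [Function.update_of_ne hk]
    exact one_mem _

lemma onQubit_apply (l : Fin n) (U : Matrix (Fin 2) (Fin 2) ℂ) (i j : Qubits n) :
    onQubit l U i j = if ∀ k ≠ l, i k = j k then U (i l) (j l) else 0 := by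
  rw [onQubit, tensor, of_apply]
  split_ifs with h
  · rw [Finset.prod_eq_single_of_mem l (Finset.mem_univ l) fun k _ hk => by simp [hk, h k hk],
      Function.update_self]
  · push Not at h
    obtain ⟨k, hk, hij⟩ := h
    exact Finset.prod_eq_zero (Finset.mem_univ k) (by simp [hk, hij])

lemma onQubit_diagonal (l : Fin n) (d : Fin 2 → ℂ) :
    onQubit l (diagonal d) = diagonal fun i => d (i l) := by
  ext i j
  obtain rfl | hij := eq_or_ne i j
  · simp [onQubit_apply]
  · rw [onQubit_apply, diagonal_apply_ne _ hij, ite_eq_right_iff]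
    intro h
    refine diagonal_apply_ne d fun hl => hij (funext fun k => ?_)
    obtain rfl | hk := eq_or_ne k l
    exacts [hl, h k hk]

lemma mul_onQubit_apply (C : QMat n) (l : Fin n) (U : Matrix (Fin 2) (Fin 2) ℂ) (i j : Qubits n) :
    (C * onQubit l U) i j = ∑ t, C i (Function.update j l t) * U t (j l) := by
  rw [mul_apply]
  refine (Fintype.sum_of_injective _ (Function.update_injective j l) _ _ (fun b hb => ?_)
    fun t => ?_).symm
  · rw [onQubit_apply, if_neg, mul_zero]
    intro h
    refine hb ⟨b l, Function.update_eq_iff.mpr ⟨rfl, fun k hk => (h k hk).symm⟩⟩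
  · rw [onQubit_apply, if_pos fun k hk => Function.update_of_ne hk _ _, Function.update_self]

lemma conjTranspose_onQubit_mul_mul_onQubit_apply (C : QMat n) (l : Fin n)
    (U : Matrix (Fin 2) (Fin 2) ℂ) (i j : Qubits n) :
    ((onQubit l U)ᴴ * C * onQubit l U) i j =
      (Uᴴ * of (fun s t => C (Function.update i l s) (Function.update j l t)) * U) (i l) (j l) := by
  have hleft (b : Qubits n) : ((onQubit l U)ᴴ * C) i b =
      ∑ s, Uᴴ (i l) s * C (Function.update i l s) b := by
    have h := congrArg star (mul_onQubit_apply Cᴴ l U b i)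
    rw [← conjTranspose_apply, conjTranspose_mul, conjTranspose_conjTranspose] at h
    simpa only [star_sum, star_mul', conjTranspose_apply, star_star, mul_comm] using h
  rw [mul_onQubit_apply, mul_apply]
  simp only [hleft, mul_apply, of_apply]

end OnQubit

section Range

variable {n : ℕ} {A : QMat n}

lemma Wloc_eq_image (C A : QMat n) :
    Wloc C A = (fun K : QMat n => (Cᴴ * (K * A * Kᴴ)).trace) '' SUloc n := by
  ext z
  simp only [Wloc, Set.mem_ofPred_eq, Set.mem_image, eq_comm]

lemma continuous_trace_conj (C A : QMat n) :
    Continuous fun K : QMat n => (Cᴴ * (K * A * Kᴴ)).trace := by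
  fun_prop

lemma isCompact_Wloc (C A : QMat n) : IsCompact (Wloc C A) := by
  rw [Wloc_eq_image]
  exact isCompact_SUloc.image (continuous_trace_conj C A)

lemma isPreconnected_Wloc (C A : QMat n) : IsPreconnected (Wloc C A) := by
  rw [Wloc_eq_image]
  exact isPreconnected_SUloc.image _ (continuous_trace_conj C A).continuousOn

lemma trace_self_mem_Wloc (A : QMat n) : (Aᴴ * A).trace ∈ Wloc A A :=
  ⟨1, one_mem_SUloc, by rw [conjTranspose_one, Matrix.one_mul, Matrix.mul_one]⟩

lemma Wloc_conj_subset {V : QMat n} (hV : V ∈ SUloc n) (C A : QMat n) :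
    Wloc C (V * A * Vᴴ) ⊆ Wloc C A := by
  rintro z ⟨K, hK, rfl⟩
  refine ⟨K * V, mul_mem_SUloc hK hV, ?_⟩
  simp only [conjTranspose_mul, Matrix.mul_assoc]

lemma conj_conj_of_mem_SUloc {V : QMat n} (hV : V ∈ SUloc n) (A : QMat n) :
    V * (Vᴴ * A * V) * Vᴴ = A := by
  calc V * (Vᴴ * A * V) * Vᴴ = V * Vᴴ * A * (V * Vᴴ) := by simp only [Matrix.mul_assoc]
    _ = A := by rw [mul_conjTranspose_self_of_mem_SUloc hV, Matrix.one_mul, Matrix.mul_one]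

lemma Wloc_conj {V : QMat n} (hV : V ∈ SUloc n) (C A : QMat n) :
    Wloc C (V * A * Vᴴ) = Wloc C A := by
  have hV' := conjTranspose_mem_SUloc hV
  refine (Wloc_conj_subset hV C A).antisymm ?_
  have h := Wloc_conj_subset hV' C (V * A * Vᴴ)
  have hA := conj_conj_of_mem_SUloc hV' A
  rw [conjTranspose_conjTranspose] at h hA
  rwa [hA] at h

lemma mul_mem_Wloc_smul (u : ℂ) {C : QMat n} {z : ℂ} (hz : z ∈ Wloc C A) :
    u * z ∈ Wloc C (u • A) := by
  obtain ⟨K, hK, rfl⟩ := hz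
  exact ⟨K, hK, by simp only [Matrix.mul_smul, Matrix.smul_mul, trace_smul, smul_eq_mul]⟩

/-- The local unitary orbit of `A` is invariant under multiplication by phases. This is the property
of the orbit which corresponds to the rotational symmetry of the sets `Wloc C A`. -/
def IsLocallyRotatable (A : QMat n) : Prop :=
  ∀ u : ℂ, ‖u‖ = 1 → ∃ K ∈ SUloc n, K * A * Kᴴ = u • A

lemma IsLocallyRotatable.isRotationallySymmetric_Wloc (hA : IsLocallyRotatable A) (C : QMat n) :
    IsRotationallySymmetric (Wloc C A) := by
  intro u hu z hz
  obtain ⟨K, hK, hKA⟩ := hA u hu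
  rw [← Wloc_conj hK, hKA]
  exact mul_mem_Wloc_smul u hz

open scoped ComplexOrder in
lemma isLocallyRotatable_of_isRotationallySymmetric_Wloc_self
    (hA : IsRotationallySymmetric (Wloc A A)) : IsLocallyRotatable A := by
  intro u hu
  obtain ⟨K, hK, hKA⟩ := hA u hu _ (trace_self_mem_Wloc A)
  have hu' : star u * u = 1 := by simpa [hu] using Complex.conj_mul' u
  have hnorm : ((u • A)ᴴ * (u • A)).trace = (Aᴴ * A).trace := by
    rw [conjTranspose_smul, smul_mul_smul_comm, hu', one_smul]
  refine ⟨K, hK, eq_of_trace_conjTranspose_mul_eq ?_ ?_⟩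
  · rw [trace_conjTranspose_mul_self_conj (conjTranspose_mul_self_of_mem_SUloc hK), hnorm]
  · rw [hnorm, conjTranspose_smul, Matrix.smul_mul, trace_smul, ← hKA, smul_eq_mul, ← mul_assoc,
      hu', one_mul]

lemma IsCentredDisc.isRotationallySymmetric {S : Set ℂ} (hS : IsCentredDisc S) :
    IsRotationallySymmetric S := by
  obtain ⟨r, -, rfl⟩ := hS
  intro u hu z hz
  simpa [hu] using hz

lemma isCentredDisc_of_isCompact_of_isPreconnected {S : Set ℂ} (hc : IsCompact S)
    (hp : IsPreconnected S) (h0 : 0 ∈ S) (hr : IsRotationallySymmetric S) : IsCentredDisc S := by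
  obtain ⟨w, hw, hmax⟩ := hc.exists_isMaxOn ⟨0, h0⟩ continuous_norm.continuousOn
  refine ⟨‖w‖, norm_nonneg w, Set.Subset.antisymm (fun z hz => ?_) fun z hz => ?_⟩
  · simpa using hmax hz
  · obtain ⟨y, hy, hyz⟩ : ‖z‖ ∈ norm '' S :=
      (hp.image norm continuous_norm.continuousOn).Icc_subset ⟨0, h0, norm_zero⟩ ⟨w, hw, rfl⟩
        ⟨norm_nonneg z, mem_closedBall_zero_iff.mp hz⟩
    obtain rfl | hy0 := eq_or_ne y 0
    · rwa [norm_eq_zero.mp (hyz.symm.trans norm_zero)]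
    · have hunit : ‖z / y‖ = 1 := by rw [norm_div, hyz, div_self (by rwa [← hyz, norm_ne_zero_iff])]
      simpa only [div_mul_cancel₀ z hy0] using hr (z / y) hunit y hy

end Range

section SignReversal

variable {n : ℕ}

lemma IsLocallyRotatable.exists_conj_add_smul_conjTranspose_eq_neg {A : QMat n}
    (hA : IsLocallyRotatable A) :
    ∃ K ∈ SUloc n, ∀ c : ℂ, K * (A + c • Aᴴ) * Kᴴ = -(A + c • Aᴴ) := by
  obtain ⟨K, hK, hKA⟩ := hA (-1) (by simp)
  rw [neg_one_smul] at hKA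
  have hKA' : K * Aᴴ * Kᴴ = -Aᴴ := by
    rw [← conjTranspose_mul_mul_conjTranspose, hKA, conjTranspose_neg]
  refine ⟨K, hK, fun c => ?_⟩
  rw [Matrix.mul_add, Matrix.add_mul, Matrix.mul_smul, Matrix.smul_mul, hKA, hKA', smul_neg,
    neg_add]

lemma re_image_Wloc_self {H : QMat n} (hs : LocallySignReversible H) :
    Complex.re '' Wloc H H = Set.Icc (-frobNorm H ^ 2) (frobNorm H ^ 2) := by
  have hre : (Hᴴ * H).trace.re = frobNorm H ^ 2 := by
    rw [trace_conjTranspose_mul_self_eq_frobNorm_sq, Complex.ofReal_re]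
  refine Set.Subset.antisymm ?_ ?_
  · rintro _ ⟨_, ⟨K, hK, rfl⟩, rfl⟩
    rw [← hre]
    exact abs_le.mp (abs_re_trace_conjTranspose_mul_le
      (trace_conjTranspose_mul_self_conj (conjTranspose_mul_self_of_mem_SUloc hK) H))
  · obtain ⟨K, hK, hKH⟩ := hs
    refine ((isPreconnected_Wloc H H).image _ Complex.continuous_re.continuousOn).Icc_subset
      ⟨_, ⟨K, hK, rfl⟩, ?_⟩ ⟨_, trace_self_mem_Wloc H, hre⟩
    rw [hKH, Matrix.mul_neg, trace_neg, Complex.neg_re, hre]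

lemma Wloc_self_eq_Icc {H : QMat n} (hH : H.IsHermitian) (hs : LocallySignReversible H) :
    Wloc H H = Complex.ofReal '' Set.Icc (-frobNorm H ^ 2) (frobNorm H ^ 2) := by
  have hreal : ∀ z ∈ Wloc H H, (z.re : ℂ) = z := by
    rintro _ ⟨K, -, rfl⟩
    exact Complex.ext rfl
      (im_trace_mul_eq_zero hH.conjTranspose (isHermitian_mul_mul_conjTranspose K hH)).symm
  rw [← re_image_Wloc_self hs, Set.image_image, Set.image_congr hreal, Set.image_id']

end SignReversal

section MatrixUnits

variable {n : ℕ} {i j : Qubits n}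

lemma mul_diagonal_mul_conjTranspose_apply {ι R : Type*} [Fintype ι] [DecidableEq ι]
    [CommSemiring R] [StarRing R] (d : ι → R) (A : Matrix ι ι R) (i j : ι) :
    (diagonal d * A * (diagonal d)ᴴ) i j = d i * star (d j) * A i j := by
  rw [diagonal_conjTranspose, mul_diagonal, diagonal_mul, Pi.star_apply, mul_right_comm]

lemma isLocallyRotatable_single (hij : i ≠ j) (z : ℂ) : IsLocallyRotatable (single i j z) := by
  intro u hu
  obtain ⟨l, hl⟩ := Function.ne_iff.mp hij
  obtain ⟨d, hd, hdu⟩ := exists_diagonal_mem_specialUnitaryGroup hl hu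
  refine ⟨onQubit l (diagonal d), onQubit_mem_SUloc l hd, ?_⟩
  ext a b
  rw [onQubit_diagonal, mul_diagonal_mul_conjTranspose_apply, Matrix.smul_apply, smul_eq_mul,
    single_apply]
  split_ifs with h
  · rw [← h.1, ← h.2, hdu]
  · rw [mul_zero, mul_zero]

lemma trace_mul_conj_single {ι R : Type*} [Fintype ι] [DecidableEq ι] [CommSemiring R] [StarRing R]
    (C K : Matrix ι ι R) (i j : ι) (z : R) :
    (C * (K * single i j z * Kᴴ)).trace = (Kᴴ * C * K) j i * z := by
  calc (C * (K * single i j z * Kᴴ)).trace = (Kᴴ * C * K * single i j z).trace := by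
        rw [← Matrix.mul_assoc, trace_mul_comm]
        simp only [Matrix.mul_assoc]
    _ = (Kᴴ * C * K) j i * z := by rw [trace_mul_single, op_smul_eq_mul]

lemma zero_mem_Wloc_single (hij : i ≠ j) (z : ℂ) (C : QMat n) : 0 ∈ Wloc C (single i j z) := by
  obtain ⟨l, hl⟩ := Function.ne_iff.mp hij
  obtain ⟨U, hU, h⟩ := exists_conj_apply_eq_zero
    (of fun s t => Cᴴ (Function.update j l s) (Function.update i l t)) hl.symm
  refine ⟨onQubit l U, onQubit_mem_SUloc l hU, ?_⟩
  rw [trace_mul_conj_single, conjTranspose_onQubit_mul_mul_onQubit_apply, h, zero_mul]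

lemma isCentredDisc_Wloc_single (hij : i ≠ j) (z : ℂ) (C : QMat n) :
    IsCentredDisc (Wloc C (single i j z)) :=
  isCentredDisc_of_isCompact_of_isPreconnected (isCompact_Wloc _ _) (isPreconnected_Wloc _ _)
    (zero_mem_Wloc_single hij z C)
    ((isLocallyRotatable_single hij z).isRotationallySymmetric_Wloc C)

lemma exists_mul_single_mul_conjTranspose_eq_single (x y : Fin 2) :
    ∃ F ∈ specialUnitaryGroup (Fin 2) ℂ, ∃ u : ℂ, ‖u‖ = 1 ∧
      F * single x y 1 * Fᴴ = single y x u := by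
  obtain rfl | hxy := eq_or_ne x y
  · exact ⟨1, one_mem _, 1, norm_one, by simp⟩
  · refine ⟨suMatrix !₂[0, 1], suMatrix_mem (by simp [EuclideanSpace.norm_eq]), -1, by simp, ?_⟩
    obtain ⟨rfl, rfl⟩ | ⟨rfl, rfl⟩ : (x = 0 ∧ y = 1) ∨ (x = 1 ∧ y = 0) := by omega
    all_goals
      ext a b
      fin_cases a <;> fin_cases b <;> simp [suMatrix, vecMul, dotProduct]

lemma exists_conj_single_eq_swap (i j : Qubits n) (z : ℂ) :
    ∃ K ∈ SUloc n, ∃ u : ℂ, ‖u‖ = 1 ∧ K * single i j z * Kᴴ = single j i (u * z) := by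
  choose F hF u hu hswap using
    fun l => exists_mul_single_mul_conjTranspose_eq_single (i l) (j l)
  refine ⟨tensor F, ⟨F, hF, rfl⟩, ∏ l, u l, by simp [hu], ?_⟩
  have hz : single i j z = z • tensor fun l => single (i l) (j l) 1 := by
    rw [tensor_single, Finset.prod_const_one, smul_single, smul_eq_mul, mul_one]
  rw [hz, Matrix.mul_smul, Matrix.smul_mul, conjTranspose_tensor, tensor_mul, tensor_mul]
  simp only [hswap, tensor_single, smul_single, smul_eq_mul, mul_comm]

lemma Wloc_single_conjTranspose (hij : i ≠ j) (z : ℂ) (C : QMat n) :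
    Wloc C (single i j z)ᴴ = Wloc C (single i j z) := by
  obtain ⟨K, hK, u, hu, hswap⟩ := exists_conj_single_eq_swap i j z
  obtain ⟨v, hv, hvz⟩ : ∃ v : ℂ, ‖v‖ = 1 ∧ v * (u * z) = star z := by
    obtain rfl | hz := eq_or_ne z 0
    · exact ⟨1, norm_one, by simp⟩
    · have hu0 : u ≠ 0 := norm_ne_zero_iff.mp (hu.trans_ne one_ne_zero)
      exact ⟨star z / (u * z), by simp [hu, hz], div_mul_cancel₀ _ (mul_ne_zero hu0 hz)⟩
  obtain ⟨L, hL, hrot⟩ := isLocallyRotatable_single hij.symm (u * z) v hv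
  rw [← Wloc_conj hK C (single i j z), hswap, ← Wloc_conj hL C (single j i _), hrot,
    conjTranspose_single, smul_single, smul_eq_mul, hvz]

end MatrixUnits

section Decomposition

lemma sum_single_filter_rel {ι R : Type*} [Fintype ι] [DecidableEq ι] [AddCommMonoid R]
    (r : ι → ι → Prop) [DecidableRel r] (H : Matrix ι ι R) :
    ∑ p : ι × ι with r p.1 p.2, single p.1 p.2 (H p.1 p.2) =
      of fun a b => if r a b then H a b else 0 := by
  rw [matrix_eq_sum_single (of _), Finset.sum_filter, Fintype.sum_prod_type]
  simp only [of_apply, apply_ite (single _ _), single_zero]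

lemma eq_sum_single_add_conjTranspose {ι R : Type*} [Fintype ι] [DecidableEq ι] [AddCommMonoid R]
    [StarAddMonoid R] (r : ι → ι → Prop) [DecidableRel r] [Std.Trichotomous r] [Std.Asymm r]
    {H : Matrix ι ι R} (hH : H.IsHermitian) (h0 : ∀ i, H i i = 0) :
    H = ∑ p : ι × ι with r p.1 p.2,
      (single p.1 p.2 (H p.1 p.2) + (single p.1 p.2 (H p.1 p.2))ᴴ) := by
  ext a b
  rw [Finset.sum_add_distrib, ← conjTranspose_sum, Matrix.add_apply, conjTranspose_apply,
    sum_single_filter_rel, of_apply, of_apply, apply_ite star, star_zero, hH.apply]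
  obtain hab | rfl | hab := Std.Trichotomous.rel_or_eq_or_rel_swap (r := r) (a := a) (b := b)
  · rw [if_pos hab, if_neg (Std.Asymm.asymm _ _ hab), add_zero]
  · simp only [h0, ite_self, add_zero]
  · rw [if_neg (Std.Asymm.asymm _ _ hab), if_pos hab, zero_add]

lemma card_filter_rel_le_choose_two {ι : Type*} [Fintype ι] (r : ι → ι → Prop)
    [DecidableRel r] [Std.Asymm r] :
    (Finset.univ.filter fun p : ι × ι => r p.1 p.2).card ≤ (Fintype.card ι).choose 2 := by
  classical
  rw [← Sym2.card_subtype_not_diag, ← Fintype.card_subtype]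
  refine Fintype.card_le_of_injective (fun p => ⟨s(p.1.1, p.1.2), fun h => ?_⟩) ?_
  · have hp := p.2
    rw [Sym2.mk_isDiag_iff.mp h] at hp
    exact Std.Asymm.asymm _ _ hp hp
  · rintro ⟨⟨a, b⟩, hab⟩ ⟨⟨c, d⟩, hcd⟩ h
    obtain ⟨rfl, rfl⟩ | ⟨rfl, rfl⟩ := Sym2.eq_iff.mp (Subtype.mk.inj h)
    · rfl
    · exact absurd hab (Std.Asymm.asymm _ _ hcd)

lemma apply_self_eq_zero_of_diagonal_conj_eq_neg {ι R : Type*} [Fintype ι] [DecidableEq ι]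
    [CommRing R] [StarRing R] [NoZeroDivisors R] [CharZero R] {d : ι → R} {A : Matrix ι ι R}
    (hd : diagonal d * (diagonal d)ᴴ = 1) (hA : diagonal d * A * (diagonal d)ᴴ = -A) (i : ι) :
    A i i = 0 := by
  have hunit : d i * star (d i) = 1 := by
    simpa [diagonal_conjTranspose] using congrFun (congrFun hd i) i
  have hneg : A i i = -A i i := by
    rw [← Matrix.neg_apply, ← hA, mul_diagonal_mul_conjTranspose_apply, hunit, one_mul]
  exact self_eq_neg.mp hneg

variable {n : ℕ}

lemma exists_conj_eq_diagonal_of_mem_SUloc {K : QMat n} (hK : K ∈ SUloc n) :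
    ∃ V ∈ SUloc n, ∃ d : Qubits n → ℂ, Vᴴ * K * V = diagonal d := by
  obtain ⟨U, hU, rfl⟩ := hK
  choose V hV d h using fun l => exists_conj_eq_diagonal (hU l)
  refine ⟨tensor V, ⟨V, hV, rfl⟩, fun i => ∏ l, d l (i l), ?_⟩
  simp only [conjTranspose_tensor, tensor_mul, h, tensor_diagonal]

lemma LocallySignReversible.exists_conj_apply_self_eq_zero {H : QMat n}
    (hs : LocallySignReversible H) : ∃ V ∈ SUloc n, ∀ i, (Vᴴ * H * V) i i = 0 := by
  obtain ⟨K, hK, hKH⟩ := hs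
  obtain ⟨V, hV, d, hd⟩ := exists_conj_eq_diagonal_of_mem_SUloc hK
  have hdmem : diagonal d ∈ SUloc n :=
    hd ▸ mul_mem_SUloc (mul_mem_SUloc (conjTranspose_mem_SUloc hV) hK) hV
  refine ⟨V, hV, apply_self_eq_zero_of_diagonal_conj_eq_neg
    (mul_conjTranspose_self_of_mem_SUloc hdmem) ?_⟩
  calc diagonal d * (Vᴴ * H * V) * (diagonal d)ᴴ
      = Vᴴ * (K * (V * (Vᴴ * H * V) * Vᴴ) * Kᴴ) * V := by
        simp only [← hd, conjTranspose_mul, conjTranspose_conjTranspose, Matrix.mul_assoc]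
    _ = -(Vᴴ * H * V) := by
        rw [conj_conj_of_mem_SUloc hV, hKH, Matrix.mul_neg, Matrix.neg_mul]

lemma exists_sum_conj_single_add_conjTranspose {H : QMat n} (hH : H.IsHermitian)
    (hs : LocallySignReversible H) :
    ∃ V ∈ SUloc n, ∃ s : Finset (Qubits n × Qubits n), s.card ≤ (2 ^ n).choose 2 ∧
      (∀ p ∈ s, p.1 ≠ p.2) ∧ ∃ z : Qubits n × Qubits n → ℂ,
        H = ∑ p ∈ s, (V * single p.1 p.2 (z p) * Vᴴ + (V * single p.1 p.2 (z p) * Vᴴ)ᴴ) := by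
  classical
  obtain ⟨V, hV, h0⟩ := hs.exists_conj_apply_self_eq_zero
  let r : Qubits n → Qubits n → Prop := WellOrderingRel
  have hsum := eq_sum_single_add_conjTranspose r (isHermitian_conjTranspose_mul_mul V hH) h0
  refine ⟨V, hV, Finset.univ.filter fun p => r p.1 p.2, ?_, fun p hp h => ?_,
    fun p => (Vᴴ * H * V) p.1 p.2, ?_⟩
  · simpa using card_filter_rel_le_choose_two r
  · exact irrefl (r := r) p.2 (h ▸ (Finset.mem_filter.mp hp).2)
  · conv_lhs => rw [← conj_conj_of_mem_SUloc hV H, hsum]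
    simp only [Finset.mul_sum, Finset.sum_mul, Matrix.mul_add, Matrix.add_mul,
      conjTranspose_mul_mul_conjTranspose]

lemma exists_sum_add_conjTranspose_isCentredDisc_Wloc {H : QMat n} (hH : H.IsHermitian)
    (hs : LocallySignReversible H) :
    ∃ m : ℕ, m ≤ (2 ^ n).choose 2 ∧ ∃ P : Fin m → QMat n, H = ∑ l, (P l + (P l)ᴴ) ∧
      ∀ l C, Wloc C (P l) = Wloc C (P l)ᴴ ∧ IsRotationallySymmetric (Wloc C (P l)) ∧
        IsCentredDisc (Wloc C (P l)) := by
  obtain ⟨V, hV, s, hcard, hne, z, hsum⟩ := exists_sum_conj_single_add_conjTranspose hH hs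
  let e := s.equivFin.symm
  let P (p : Qubits n × Qubits n) : QMat n := V * single p.1 p.2 (z p) * Vᴴ
  refine ⟨s.card, hcard, fun l => P (e l), ?_, fun l C => ?_⟩
  · rw [hsum, ← Finset.sum_coe_sort s, ← e.sum_comp]
  · have hij := hne _ (e l).2
    rw [conjTranspose_mul_mul_conjTranspose, Wloc_conj hV, Wloc_conj hV,
      Wloc_single_conjTranspose hij]
    have hdisc := isCentredDisc_Wloc_single hij (z (e l)) C
    exact ⟨rfl, hdisc.isRotationallySymmetric, hdisc⟩

end Decomposition

section Counterexample

/-- The matrix `|0…0⟩⟨0…0| - |1…1⟩⟨1…1|`. For `n ≥ 3` a single pair of rotatable matrices does not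
suffice to decompose it. -/
def zerosSubOnes (n : ℕ) : QMat n :=
  tensor (fun _ => single 0 0 1) - tensor (fun _ => single 1 1 1)

/-- The Pauli matrix `Z`. -/
def pauliZ : Matrix (Fin 2) (Fin 2) ℂ := diagonal ![1, -1]

/-- The Pauli string `⨂ Z` over the qubits in `s`, with the identity on the other qubits. Its traces
against a density matrix are the spin correlations of the qubits in `s`. -/
def zString {n : ℕ} (s : Finset (Fin n)) : QMat n := tensor fun l => if l ∈ s then pauliZ else 1

/-- The third coordinate of the Bloch vector of the state `U |0⟩`. -/
noncomputable def polarization (U : Matrix (Fin 2) (Fin 2) ℂ) : ℝ := ‖U 0 0‖ ^ 2 - ‖U 1 0‖ ^ 2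

variable {n : ℕ}

lemma isHermitian_zerosSubOnes : (zerosSubOnes n).IsHermitian := by
  simp [IsHermitian, zerosSubOnes, conjTranspose_tensor]

lemma locallySignReversible_zerosSubOnes : LocallySignReversible (zerosSubOnes n) := by
  let J := suMatrix !₂[0, 1]
  have hJ : J ∈ specialUnitaryGroup (Fin 2) ℂ :=
    suMatrix_mem (by simp [EuclideanSpace.norm_eq])
  have h0 : J * single 0 0 1 * Jᴴ = single 1 1 1 := by
    ext i j
    fin_cases i <;> fin_cases j <;> simp [J, suMatrix, vecMul, dotProduct]
  have h1 : J * single 1 1 1 * Jᴴ = single 0 0 1 := by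
    ext i j
    fin_cases i <;> fin_cases j <;> simp [J, suMatrix, vecMul, dotProduct]
  refine ⟨tensor fun _ => J, ⟨_, fun _ => hJ, rfl⟩, ?_⟩
  simp only [zerosSubOnes, conjTranspose_tensor, Matrix.mul_sub, Matrix.sub_mul, tensor_mul, h0, h1,
    neg_sub]

lemma isHermitian_zString (s : Finset (Fin n)) : (zString s).IsHermitian := by
  have hZ : pauliZᴴ = pauliZ := by
    rw [pauliZ, diagonal_conjTranspose]
    congr 1
    ext i
    fin_cases i <;> simp
  simp only [IsHermitian, zString, conjTranspose_tensor, apply_ite conjTranspose, hZ,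
    conjTranspose_one]

lemma trace_zString_mul_tensor (s : Finset (Fin n)) {A : Fin n → Matrix (Fin 2) (Fin 2) ℂ}
    (hA : ∀ l, (A l).trace = 1) :
    (zString s * tensor A).trace = ∏ l ∈ s, (pauliZ * A l).trace := by
  simp only [zString, tensor_mul, trace_tensor, ite_mul, Matrix.one_mul, apply_ite trace, hA,
    Finset.prod_ite_mem, Finset.univ_inter]

lemma trace_pauliZ_mul_conj_single_zero (U : Matrix (Fin 2) (Fin 2) ℂ) :
    (pauliZ * (U * single 0 0 1 * Uᴴ)).trace = ((polarization U : ℝ) : ℂ) := by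
  rw [trace_mul_conj_single]
  simp [pauliZ, polarization, mul_apply, Complex.conj_mul', sub_eq_add_neg]

lemma trace_pauliZ_mul_conj_single_one {U : Matrix (Fin 2) (Fin 2) ℂ}
    (hU : U ∈ specialUnitaryGroup (Fin 2) ℂ) :
    (pauliZ * (U * single 1 1 1 * Uᴴ)).trace = ((-polarization U : ℝ) : ℂ) := by
  obtain ⟨v, -, rfl⟩ := exists_eq_suMatrix hU
  rw [trace_mul_conj_single]
  simp [pauliZ, polarization, suMatrix, mul_apply, Complex.mul_conj', sub_eq_add_neg]

lemma polarization_le_one {U : Matrix (Fin 2) (Fin 2) ℂ}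
    (hU : U ∈ specialUnitaryGroup (Fin 2) ℂ) : polarization U ≤ 1 := by
  obtain ⟨v, hv, rfl⟩ := exists_eq_suMatrix hU
  have hsum : ‖v 0‖ ^ 2 + ‖v 1‖ ^ 2 = 1 := by
    rw [← Fin.sum_univ_two (fun i => ‖v i‖ ^ 2), ← EuclideanSpace.norm_sq_eq, hv, one_pow]
  calc polarization (suMatrix v) = ‖v 0‖ ^ 2 - ‖v 1‖ ^ 2 := by simp [polarization, suMatrix]
    _ ≤ 1 := by linarith [sq_nonneg ‖v 1‖]

lemma trace_zString_mul_conj_zerosSubOnes {s : Finset (Fin n)} (hs : Odd s.card)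
    {U : Fin n → Matrix (Fin 2) (Fin 2) ℂ} (hU : ∀ l, U l ∈ specialUnitaryGroup (Fin 2) ℂ) :
    (zString s * (tensor U * zerosSubOnes n * (tensor U)ᴴ)).trace =
      ((2 * ∏ l ∈ s, polarization (U l) : ℝ) : ℂ) := by
  have htr (x : Fin 2) (l : Fin n) : (U l * single x x 1 * (U l)ᴴ).trace = 1 := by
    rw [trace_mul_cycle, conjTranspose_mul_self_of_mem_specialUnitaryGroup (hU l), Matrix.one_mul,
      trace_single_eq_same]
  simp only [zerosSubOnes, conjTranspose_tensor, Matrix.mul_sub, Matrix.sub_mul, tensor_mul,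
    trace_sub, trace_zString_mul_tensor s (htr _), trace_pauliZ_mul_conj_single_zero,
    trace_pauliZ_mul_conj_single_one (hU _), ← Complex.ofReal_prod, ← Complex.ofReal_sub,
    Finset.prod_neg, hs.neg_one_pow, neg_one_mul, sub_neg_eq_add, two_mul]

lemma re_mul_trace_zString_mul_eq_prod_polarization {P : QMat n}
    {U : Fin n → Matrix (Fin 2) (Fin 2) ℂ} (hU : ∀ l, U l ∈ specialUnitaryGroup (Fin 2) ℂ)
    (hPH : zerosSubOnes n = P + Pᴴ) {u : ℂ} (hUP : tensor U * P * (tensor U)ᴴ = u • P)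
    {s : Finset (Fin n)} (hs : Odd s.card) :
    (u * (zString s * P).trace).re = ∏ l ∈ s, polarization (U l) := by
  have h := trace_zString_mul_conj_zerosSubOnes hs hU
  rw [hPH, Matrix.mul_add, Matrix.add_mul, ← conjTranspose_mul_mul_conjTranspose, hUP,
    trace_mul_add_conjTranspose (isHermitian_zString s), Complex.ofReal_inj, Matrix.mul_smul,
    trace_smul, smul_eq_mul] at h
  linarith

lemma eq_one_of_forall_re_mul_le_one {q : ℂ} (hq : q.re = 1)
    (h : ∀ u : ℂ, ‖u‖ = 1 → (u * q).re ≤ 1) : q = 1 := by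
  obtain ⟨u, hu, huq⟩ := Complex.exists_norm_eq_mul_self q
  have hle : ‖q‖ ≤ 1 := by simpa only [← huq, Complex.ofReal_re] using h u hu
  have him : q.im = 0 := by
    rw [← Complex.abs_re_eq_norm, hq, abs_one]
    exact le_antisymm (hq ▸ Complex.re_le_norm q) hle
  exact Complex.ext hq him

lemma not_forall_re_mul_eq_re_pow_three (q : ℂ) :
    ¬ ∀ u : ℂ, ‖u‖ = 1 → (u * q).re = u.re ^ 3 := by
  intro h
  have hre : q.re = 1 := by simpa using h 1 norm_one
  have him : q.im = 0 := by simpa using h Complex.I Complex.norm_I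
  have hnorm : ‖(⟨3 / 5, 4 / 5⟩ : ℂ)‖ = 1 := by
    rw [← pow_eq_one_iff_of_nonneg (norm_nonneg _) two_ne_zero, Complex.sq_norm, Complex.normSq_mk]
    norm_num
  have hcube := h _ hnorm
  norm_num [Complex.mul_re, hre, him] at hcube

lemma trace_zString_singleton_mul_eq_one {P : QMat n} (hP : IsLocallyRotatable P)
    (hPH : zerosSubOnes n = P + Pᴴ) (l : Fin n) : (zString {l} * P).trace = 1 := by
  have hodd : Odd (Finset.card {l}) := by simp
  refine eq_one_of_forall_re_mul_le_one ?_ fun u hu => ?_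
  · have hone : tensor (fun _ => 1) * P * (tensor fun _ => 1)ᴴ = (1 : ℂ) • P := by
      simp only [tensor_one, conjTranspose_one, Matrix.one_mul, Matrix.mul_one, one_smul]
    have h := re_mul_trace_zString_mul_eq_prod_polarization (fun _ => one_mem _) hPH hone hodd
    simpa [polarization] using h
  · obtain ⟨_, ⟨U, hU, rfl⟩, hUP⟩ := hP u hu
    rw [re_mul_trace_zString_mul_eq_prod_polarization hU hPH hUP hodd, Finset.prod_singleton]
    exact polarization_le_one (hU l)

lemma not_isLocallyRotatable_of_zerosSubOnes_eq (hn : 3 ≤ n) {P : QMat n}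
    (hPH : zerosSubOnes n = P + Pᴴ) : ¬ IsLocallyRotatable P := by
  intro hP
  obtain ⟨s, hs⟩ : ∃ s : Finset (Fin n), s.card = 3 :=
    ⟨Finset.univ.map (Fin.castLEEmb hn), by simp⟩
  refine not_forall_re_mul_eq_re_pow_three (zString s * P).trace fun u hu => ?_
  obtain ⟨_, ⟨U, hU, rfl⟩, hUP⟩ := hP u hu
  have hpol (l : Fin n) : polarization (U l) = u.re := by
    have h := re_mul_trace_zString_mul_eq_prod_polarization hU hPH hUP (s := {l}) (by simp)
    rw [trace_zString_singleton_mul_eq_one hP hPH, mul_one, Finset.prod_singleton] at h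
    exact h.symm
  have hodd : Odd s.card := hs ▸ by decide
  rw [re_mul_trace_zString_mul_eq_prod_polarization hU hPH hUP hodd]
  simp only [hpol, Finset.prod_const, hs]

end Counterexample

end LocalNumericalRange

open LocalNumericalRange in
theorem mainTheorem1_general :
    (∀ (n : ℕ) (A : QMat n), IsRotationallySymmetric (Wloc A A) →
      (∃ K ∈ SUloc n, ∀ c : ℂ, K * (A + c • Aᴴ) * Kᴴ = -(A + c • Aᴴ)) ∧
      LocallySignReversible (A + Aᴴ) ∧
      Wloc (A + Aᴴ) (A + Aᴴ) =
        Complex.ofReal '' Set.Icc (-frobNorm (A + Aᴴ) ^ 2) (frobNorm (A + Aᴴ) ^ 2)) ∧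
    (∀ n : ℕ, 3 ≤ n → ∃ H : QMat n, H.IsHermitian ∧ LocallySignReversible H ∧
      ¬ ∃ P : QMat n, H = P + Pᴴ ∧ IsRotationallySymmetric (Wloc P P)) ∧
    (∀ (n : ℕ) (H : QMat n), H.IsHermitian → LocallySignReversible H →
      ∃ m : ℕ, m ≤ (2 ^ n).choose 2 ∧ ∃ P : Fin m → QMat n, H = ∑ l, (P l + (P l)ᴴ) ∧
        ∀ l C, Wloc C (P l) = Wloc C (P l)ᴴ ∧ IsRotationallySymmetric (Wloc C (P l)) ∧
          IsCentredDisc (Wloc C (P l))) := by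
  refine ⟨fun n A hA => ?_, fun n hn => ?_, fun n H hH hs => ?_⟩
  · obtain ⟨K, hK, hrev⟩ := (isLocallyRotatable_of_isRotationallySymmetric_Wloc_self
      hA).exists_conj_add_smul_conjTranspose_eq_neg
    have hs : LocallySignReversible (A + Aᴴ) := ⟨K, hK, by simpa only [one_smul] using hrev 1⟩
    exact ⟨⟨K, hK, hrev⟩, hs, Wloc_self_eq_Icc (isHermitian_add_transpose_self A) hs⟩
  · refine ⟨zerosSubOnes n, isHermitian_zerosSubOnes, locallySignReversible_zerosSubOnes, ?_⟩
    rintro ⟨P, hPH, hP⟩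
    exact not_isLocallyRotatable_of_zerosSubOnes_eq hn hPH
      (isLocallyRotatable_of_isRotationallySymmetric_Wloc_self hP)
  · exact exists_sum_add_conjTranspose_isCentredDisc_Wloc hH hs

theorem mainTheorem1 :
    -- (1) discs give sign-reversibility of all combinations, and a symmetric interval
    (∀ (n : ℕ) (A : LocalNumericalRange.QMat n),
      (∀ C : LocalNumericalRange.QMat n,
        LocalNumericalRange.IsCentredDisc (LocalNumericalRange.Wloc C A) ∧
        LocalNumericalRange.IsCentredDisc (LocalNumericalRange.Wloc C A.conjTranspose)) →
      (∃ K ∈ LocalNumericalRange.SUloc n, ∀ c : ℂ,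
        K * (A + c • A.conjTranspose) * K.conjTranspose = -(A + c • A.conjTranspose)) ∧
      LocalNumericalRange.LocallySignReversible (A + A.conjTranspose) ∧
      LocalNumericalRange.Wloc (A + A.conjTranspose) (A + A.conjTranspose) =
        Complex.ofReal '' Set.Icc
          (-LocalNumericalRange.frobNorm (A + A.conjTranspose) ^ 2)
          (LocalNumericalRange.frobNorm (A + A.conjTranspose) ^ 2)) ∧
    -- (2) the converse fails: one pair is not always enough
    (∃ (n : ℕ) (H : LocalNumericalRange.QMat n),
      H.IsHermitian ∧ LocalNumericalRange.LocallySignReversible H ∧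
      ¬ ∃ P : LocalNumericalRange.QMat n, H = P + P.conjTranspose ∧
        ∀ C : LocalNumericalRange.QMat n,
          LocalNumericalRange.IsRotationallySymmetric (LocalNumericalRange.Wloc C P) ∧
          LocalNumericalRange.IsRotationallySymmetric
            (LocalNumericalRange.Wloc C P.conjTranspose)) ∧
    -- (3) at most `2 ^ n` choose `2` pairs are always enough
    (∀ (n : ℕ) (H : LocalNumericalRange.QMat n),
      H.IsHermitian → LocalNumericalRange.LocallySignReversible H →
      ∃ m : ℕ, m ≤ (2 ^ n).choose 2 ∧ ∃ P : Fin m → LocalNumericalRange.QMat n,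
        H = ∑ l, (P l + (P l).conjTranspose) ∧
        ∀ (l : Fin m) (C : LocalNumericalRange.QMat n),
          LocalNumericalRange.Wloc C (P l) =
            LocalNumericalRange.Wloc C (P l).conjTranspose ∧
          LocalNumericalRange.IsRotationallySymmetric (LocalNumericalRange.Wloc C (P l)) ∧
          LocalNumericalRange.IsCentredDisc (LocalNumericalRange.Wloc C (P l))) := by
  obtain ⟨hpair, hconverse, hdecomposition⟩ := mainTheorem1_general
  obtain ⟨H, hH, hs, hnot⟩ := hconverse 3 le_rfl
  exact ⟨fun n A hA => hpair n A (hA A).1.isRotationallySymmetric,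
    ⟨3, H, hH, hs, fun ⟨P, hPH, hP⟩ => hnot ⟨P, hPH, (hP P).1⟩⟩, hdecomposition⟩
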